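/- Let $q$ be a complex number with $|q|<1$. For $a\in\mathbb C$ put $(a;q)_n=\prod_{j=1}^{n}(1-aq^{j-1})$ for integers $n\ge 0$ (so $(a;q)_0=1$), $(a;q)_\infty=\prod_{n=0}^{\infty}(1-aq^n)$, $(q)_n=(q;q)_n$, $(q)_\infty=(q;q)_\infty$, and $(a,b,c;q)_\infty=(a;q)_\infty(b;q)_\infty(c;q)_\infty$. For integers $0\le k\le N$ let ${N\brack k}=\dfrac{(q;q)_N}{(q;q)_k\,(q;q)_{N-k}}$ be the $q$-binomial coefficient. **Theorem.** The following series over $n$ converges absolutely, and $$ 1+\sum_{n=1}^{\infty}\ \sum_{m=-\lfloor\frac{n-1}{2}\rfloor}^{\lfloor\frac n2\rfloor} \frac{(-1)^m q^{\,n^2+m(5m-3)/2}\,(1+q^m)}{(q)_{2n}}{2n-1\brack n-2m} =\frac{1}{(q)_\infty}\Big((q^6,q^7,q^{13};q^{13})_\infty+q\,(q,q^{12},q^{13};q^{13})_\infty\Big). $$ (For $q=0$ every summand is read as its limit as $q\to0$, which is $0$.) -/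

import Mathlib

/-- The finite `q`-shifted factorial `(a; q)_n = ∏_{j=1}^{n} (1 - a q^{j-1})`. -/
noncomputable def qPoch (a q : ℂ) (n : ℕ) : ℂ :=
  ∏ j ∈ Finset.range n, (1 - a * q ^ j)

/-- The infinite `q`-shifted factorial `(a; q)_∞ = ∏_{n ≥ 0} (1 - a q^n)`. -/
noncomputable def qPochInf (a q : ℂ) : ℂ :=
  ∏' n : ℕ, (1 - a * q ^ n)

/-- For `|q| < 1` the product defining `(a; q)_∞` converges. -/
theorem multipliable_qPochInf (a : ℂ) {q : ℂ} (hq : ‖q‖ < 1) :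
    Multipliable fun n : ℕ => 1 - a * q ^ n := by
  have h : Summable fun n : ℕ => ‖-(a * q ^ n)‖ := by
    have h1 : Summable fun n : ℕ => ‖a‖ * ‖q‖ ^ n :=
      (summable_geometric_of_lt_one (norm_nonneg q) hq).mul_left _
    simpa using h1
  simpa [sub_eq_add_neg] using multipliable_one_add_of_summable h

/-- The multiple infinite `q`-shifted factorial
`(a, b, c; q)_∞ = (a; q)_∞ (b; q)_∞ (c; q)_∞`. -/
noncomputable def qPochInf₃ (a b c q : ℂ) : ℂ :=
  qPochInf a q * qPochInf b q * qPochInf c q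

/-- The `q`-binomial coefficient `[N brack k] = (q; q)_N / ((q; q)_k (q; q)_{N-k})` for
`0 ≤ k ≤ N`, and `0` for the other integers `k`. -/
noncomputable def qBinom (q : ℂ) (N : ℕ) (k : ℤ) : ℂ :=
  if 0 ≤ k ∧ k ≤ N then
    qPoch q q N / (qPoch q q k.toNat * qPoch q q (N - k.toNat))
  else 0

/-! This is a Bailey pair argument, with `qInv` for 1/(q)_n. For n ≥ 1 the inner sum is q^(n²) β_n,
where β_n = ∑_m `baileyLeft q n m`. The heart is the identity β_n = ∑_j α_j / ((q)_{n-j} (q)_{n+j})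
over all integers j, with α_{2m} = (-1)^m q^(5 `tri m` + 2m) and α_{2m+1} = (-1)^m q^(5 `tri m` +
4m). It is proved by telescoping (`tsum_baileyLeft`).

Since ∑_n q^(n²) / ((q)_{n-j} (q)_{n+j}) = q^(j²) / (q)_∞ (`tsum_sq_mul_qInv`, a limit of
q-Vandermonde), exchanging the sums leaves ∑_j α_j q^(j²) / (q)_∞. Even and odd j give theta series
with quadratic part 13 `tri m`, which the Jacobi triple product in base q^13 turns into the two
products. -/

open Filter Topology

/-! ### Reciprocal q-factorials over the integers -/

/-- The reciprocal `1 / (q; q)_n`, extended by zero to negative integers `n`. -/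
noncomputable def qInv (q : ℂ) (n : ℤ) : ℂ :=
  if 0 ≤ n then (qPoch q q n.toNat)⁻¹ else 0

/-- The integer `m (m - 1) / 2`. -/
def tri (m : ℤ) : ℤ := m * (m - 1) / 2

theorem two_mul_tri (m : ℤ) : 2 * tri m = m * (m - 1) :=
  Int.mul_ediv_cancel' (Int.even_mul_pred_self m).two_dvd

theorem tri_add_one (m : ℤ) : tri (m + 1) = tri m + m := by
  have h1 := two_mul_tri m
  have h2 := two_mul_tri (m + 1)
  linarith

theorem one_sub_pow_ne_zero {q : ℂ} (hq : ‖q‖ < 1) {n : ℕ} (hn : n ≠ 0) : 1 - q ^ n ≠ 0 := by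
  intro h
  have h1 : ‖q ^ n‖ = 1 := by rw [← sub_eq_zero.mp h, norm_one]
  rw [norm_pow] at h1
  exact (pow_lt_one₀ (norm_nonneg q) hq hn).ne h1

theorem qPoch_succ (a q : ℂ) (n : ℕ) : qPoch a q (n + 1) = qPoch a q n * (1 - a * q ^ n) :=
  Finset.prod_range_succ _ _

theorem qPoch_self_ne_zero {q : ℂ} (hq : ‖q‖ < 1) (n : ℕ) : qPoch q q n ≠ 0 := by
  refine Finset.prod_ne_zero_iff.2 fun j _ => ?_
  rw [← pow_succ']
  exact one_sub_pow_ne_zero hq j.succ_ne_zero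

theorem qInv_natCast (q : ℂ) (n : ℕ) : qInv q n = (qPoch q q n)⁻¹ := by simp [qInv]

theorem qInv_zero (q : ℂ) : qInv q 0 = 1 := by simp [qInv, qPoch]

theorem qInv_of_neg (q : ℂ) {n : ℤ} (hn : n < 0) : qInv q n = 0 := by simp [qInv, hn]

/-- Extension by zero respects this recurrence because 1 - q^0 = 0 at n = 0. Hence finite sums can
run over ℤ and be shifted without boundary terms. -/
theorem qInv_sub_one {q : ℂ} (hq : ‖q‖ < 1) (n : ℤ) :
    qInv q (n - 1) = (1 - q ^ n) * qInv q n := by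
  rcases lt_trichotomy n 0 with h | rfl | h
  · rw [qInv_of_neg q h, qInv_of_neg q (by omega), mul_zero]
  · rw [qInv_of_neg q (by omega)]; simp
  · obtain ⟨k, rfl⟩ : ∃ k : ℕ, n = (k + 1 : ℕ) := ⟨(n - 1).toNat, by omega⟩
    have h1 : ((k + 1 : ℕ) : ℤ) - 1 = (k : ℕ) := by push_cast; ring
    rw [h1, qInv_natCast, qInv_natCast, qPoch_succ, zpow_natCast, ← pow_succ']
    have := one_sub_pow_ne_zero hq k.succ_ne_zero
    have := qPoch_self_ne_zero hq k
    field_simp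

theorem tendsto_qPoch (a : ℂ) {q : ℂ} (hq : ‖q‖ < 1) :
    Tendsto (qPoch a q) atTop (𝓝 (qPochInf a q)) :=
  (multipliable_qPochInf a hq).hasProd.tendsto_prod_nat

theorem qPochInf_self_ne_zero {q : ℂ} (hq : ‖q‖ < 1) : qPochInf q q ≠ 0 := by
  have h : ∏' n : ℕ, (1 + -(q * q ^ n)) ≠ 0 := by
    apply tprod_one_add_ne_zero_of_summable
    · intro n
      rw [← sub_eq_add_neg, ← pow_succ']
      exact one_sub_pow_ne_zero hq n.succ_ne_zero
    · simpa using (summable_geometric_of_lt_one (norm_nonneg q) hq).mul_left ‖q‖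
  simpa [qPochInf, sub_eq_add_neg] using h

theorem tendsto_qInv {q : ℂ} (hq : ‖q‖ < 1) :
    Tendsto (qInv q) atTop (𝓝 (qPochInf q q)⁻¹) := by
  have h : Tendsto (fun n : ℤ => (qPoch q q n.toNat)⁻¹) atTop (𝓝 (qPochInf q q)⁻¹) :=
    ((tendsto_qPoch q hq).comp (tendsto_atTop_atTop.2 fun b => ⟨(b : ℤ), fun n hn => by omega⟩ :
      Tendsto Int.toNat atTop atTop)).inv₀ (qPochInf_self_ne_zero hq)
  refine h.congr' ?_
  filter_upwards [eventually_ge_atTop 0] with n hn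
  simp [qInv, hn]

theorem exists_norm_qInv_le {q : ℂ} (hq : ‖q‖ < 1) : ∃ C : ℝ, 0 ≤ C ∧ ∀ n, ‖qInv q n‖ ≤ C := by
  have h := ((tendsto_qPoch q hq).inv₀ (qPochInf_self_ne_zero hq)).norm.bddAbove_range
  obtain ⟨C, hC⟩ := h
  have hC' : ∀ n, ‖(qPoch q q n)⁻¹‖ ≤ C := fun n => hC ⟨n, rfl⟩
  have h0 : 0 ≤ C := (norm_nonneg _).trans (hC' 0)
  refine ⟨C, h0, fun n => ?_⟩
  unfold qInv
  split_ifs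
  · exact hC' _
  · simpa using h0

theorem summable_norm_zpow {q : ℂ} (hq : ‖q‖ < 1) (hq0 : q ≠ 0) (E : ℤ → ℤ) (C : ℤ)
    (hE : ∀ k, |k| ≤ E k + C) : Summable fun k => ‖q ^ E k‖ := by
  have hpos : 0 < ‖q‖ := norm_pos_iff.2 hq0
  have hs : Summable fun k : ℤ => ‖q‖ ^ k.natAbs := by
    refine summable_int_iff_summable_nat_and_neg.2 ⟨?_, ?_⟩ <;>
    simpa using summable_geometric_of_lt_one hpos.le hq
  refine Summable.of_nonneg_of_le (fun _ => norm_nonneg _) (fun k => ?_)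
    (hs.mul_right (‖q‖ ^ (-C)))
  rw [norm_zpow, ← zpow_natCast, ← zpow_add₀ hpos.ne', Int.natCast_natAbs]
  exact zpow_le_zpow_right_of_le_one₀ hpos hq.le (by linarith [hE k])

theorem summable_of_forall_lt {f : ℤ → ℂ} (N : ℕ) (hf : ∀ k : ℤ, (N : ℤ) < |k| → f k = 0) :
    Summable f := by
  refine summable_of_ne_finset_zero (s := Finset.Icc (-(N : ℤ)) N) fun k hk => hf k ?_
  by_contra h
  exact hk (Finset.mem_Icc.2 (abs_le.1 (not_lt.1 h)))

/-! ### The Jacobi triple product -/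

theorem tsum_qInv_finite_jacobi {q : ℂ} (hq : ‖q‖ < 1) (hq0 : q ≠ 0) {z : ℂ} (hz : z ≠ 0) (N : ℕ) :
    ∑' k : ℤ, (-1) ^ k * q ^ tri k * z ^ k * (qInv q (N - k) * qInv q (N + k))
      = qPoch z q N * qPoch (q / z) q N * qInv q (2 * N) := by
  induction N with
  | zero =>
    rw [tsum_eq_single 0]
    · simp [qInv_zero, qPoch, tri]
    · intro k hk
      rcases lt_or_gt_of_ne hk with h | h
      · rw [qInv_of_neg q (n := ((0 : ℕ) : ℤ) + k) (by omega)]; simp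
      · rw [qInv_of_neg q (n := ((0 : ℕ) : ℤ) - k) (by omega)]; simp
  | succ N ih =>
    have hs : ∀ M : ℕ, Summable fun k : ℤ =>
        (-1) ^ k * q ^ tri k * z ^ k * (qInv q (M - k) * qInv q (M + k)) := fun M => by
      refine summable_of_forall_lt M fun k hk => ?_
      rcases lt_abs.1 hk with h | h
      · rw [qInv_of_neg q (n := (M : ℤ) - k) (by omega)]; simp
      · rw [qInv_of_neg q (n := (M : ℤ) + k) (by omega)]; simp
    set f : ℤ → ℂ := fun k =>
      (-1) ^ k * q ^ tri k * z ^ k * (qInv q (N - k) * qInv q (N + k)) with hf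
    have h0 : Summable f := hs N
    have hp : Summable fun k => f (k + 1) := h0.comp_injective (add_left_injective 1)
    have hm : Summable fun k => f (k - 1) := h0.comp_injective sub_left_injective
    have ep : ∑' k, f (k + 1) = ∑' k, f k := (Equiv.addRight (1 : ℤ)).tsum_eq f
    have em : ∑' k, f (k - 1) = ∑' k, f k := (Equiv.subRight (1 : ℤ)).tsum_eq f
    -- After summation the shifts disappear, and the coefficients add up to (1 - z q^N)(1 -
    -- q^(N+1)/z), the new factors of the product.
    have key : ∀ k : ℤ, (1 - q ^ (2 * N + 1)) * (1 - q ^ (2 * N + 2)) *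
        ((-1) ^ k * q ^ tri k * z ^ k * (qInv q ((N + 1 : ℕ) - k) * qInv q ((N + 1 : ℕ) + k)))
        = (1 + q ^ (2 * N + 1)) * f k + (-(z * q ^ N)) * f (k - 1)
          + (-(q ^ (N + 1) / z)) * f (k + 1) := fun k => by
      have a1 : qInv q (N - k) = (1 - q ^ (N + 1) / q ^ k) * qInv q (N + 1 - k) := by
        rw [← zpow_natCast, ← zpow_sub₀ hq0, Nat.cast_succ, ← qInv_sub_one hq]; congr 1; ring
      have a2 : qInv q (N + k) = (1 - q ^ (N + 1) * q ^ k) * qInv q (N + 1 + k) := by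
        rw [← zpow_natCast, ← zpow_add₀ hq0, Nat.cast_succ, ← qInv_sub_one hq]; congr 1; ring
      have a3 : qInv q (N - (k + 1)) = (1 - q ^ N / q ^ k) * qInv q (N - k) := by
        rw [← zpow_natCast, ← zpow_sub₀ hq0, ← qInv_sub_one hq]; congr 1; ring
      have a4 : qInv q (N + (k - 1)) = (1 - q ^ N * q ^ k) * qInv q (N + k) := by
        rw [← zpow_natCast, ← zpow_add₀ hq0, ← qInv_sub_one hq]; congr 1; ring
      have t1 : q ^ tri (k - 1) = q ^ tri k * q / q ^ k := by
        have := tri_add_one (k - 1)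
        rw [sub_add_cancel] at this
        rw [this, zpow_add₀ hq0, zpow_sub₀ hq0]; field_simp
      simp only [hf]
      rw [a3, a4, show (N : ℤ) - (k - 1) = N + 1 - k by ring, show (N : ℤ) + (k + 1) = N + 1 + k by ring,
        a1, a2, t1, tri_add_one, zpow_add₀ hq0, zpow_add₀ hz, zpow_sub₀ hz,
        zpow_add₀ (by norm_num : (-1 : ℂ) ≠ 0), zpow_sub₀ (by norm_num : (-1 : ℂ) ≠ 0)]
      push_cast
      simp only [zpow_one]
      field_simp
      ring
    have h1 := one_sub_pow_ne_zero hq (n := 2 * N + 1) (by omega)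
    have h2 := one_sub_pow_ne_zero hq (n := 2 * N + 2) (by omega)
    have e1 : qInv q (2 * N) = (1 - q ^ (2 * N + 1)) * ((1 - q ^ (2 * N + 2)) *
        qInv q (2 * (N + 1 : ℕ))) := by
      rw [← zpow_natCast, ← zpow_natCast]
      rw [show (2 * (N + 1 : ℕ) : ℤ) = ((2 * N + 2 : ℕ) : ℤ) by push_cast; ring,
        ← qInv_sub_one hq,
        show ((2 * N + 2 : ℕ) : ℤ) - 1 = ((2 * N + 1 : ℕ) : ℤ) by push_cast; ring,
        ← qInv_sub_one hq]
      congr 1; push_cast; ring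
    apply mul_left_cancel₀ (mul_ne_zero h1 h2)
    rw [← tsum_mul_left]
    simp_rw [key]
    rw [(((h0.mul_left _).add (hm.mul_left _)).tsum_add (hp.mul_left _)),
      (h0.mul_left _).tsum_add (hm.mul_left _), tsum_mul_left, tsum_mul_left, tsum_mul_left,
      em, ep, ih, qPoch_succ, qPoch_succ, e1]
    field_simp
    ring

theorem jacobi_triple_product {q : ℂ} (hq : ‖q‖ < 1) (hq0 : q ≠ 0) {z : ℂ} (hz : z ≠ 0)
    (hs : Summable fun k : ℤ => ‖(-1) ^ k * q ^ tri k * z ^ k‖) :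
    ∑' k : ℤ, (-1) ^ k * q ^ tri k * z ^ k = qPochInf₃ z (q / z) q q := by
  obtain ⟨C, hC0, hC⟩ := exists_norm_qInv_le hq
  have h := tendsto_tsum_of_dominated_convergence (𝓕 := (atTop : Filter ℕ))
    (f := fun N k => (-1) ^ k * q ^ tri k * z ^ k * (qInv q (N - k) * qInv q (N + k)))
    (g := fun k => (-1) ^ k * q ^ tri k * z ^ k * ((qPochInf q q)⁻¹ * (qPochInf q q)⁻¹))
    (hs.mul_right (C * C)) (fun k => ?_) (Eventually.of_forall fun N k => ?_)
  · simp_rw [tsum_qInv_finite_jacobi hq hq0 hz] at h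
    have h2 : Tendsto (fun N : ℕ => qPoch z q N * qPoch (q / z) q N * qInv q (2 * N)) atTop
        (𝓝 (qPochInf z q * qPochInf (q / z) q * (qPochInf q q)⁻¹)) :=
      ((tendsto_qPoch z hq).mul (tendsto_qPoch _ hq)).mul ((tendsto_qInv hq).comp
        (tendsto_atTop_atTop.2 fun b => ⟨b.toNat, fun n hn => by omega⟩))
    have h3 := tendsto_nhds_unique h h2
    have h0 := qPochInf_self_ne_zero hq
    rw [tsum_mul_right] at h3
    field_simp at h3
    rw [h3, qPochInf₃]
    ring
  · refine Tendsto.const_mul _ (Tendsto.mul ?_ ?_)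
    · exact (tendsto_qInv hq).comp
        (tendsto_atTop_atTop.2 fun b => ⟨(b + k).toNat, fun n hn => by omega⟩)
    · exact (tendsto_qInv hq).comp
        (tendsto_atTop_atTop.2 fun b => ⟨(b - k).toNat, fun n hn => by omega⟩)
  · rw [norm_mul, norm_mul (qInv q _)]
    gcongr <;> exact hC _

/-! ### The q-Vandermonde sum and its limit -/

/-- The recurrence in N also involves c + 1, so the induction keeps c general. -/
theorem tsum_qInv_vandermonde {q : ℂ} (hq : ‖q‖ < 1) (hq0 : q ≠ 0) (N : ℕ) (c : ℤ) :
    ∑' k : ℤ, q ^ (k * (k + c)) * (qInv q k * qInv q (N - k) * qInv q (k + c))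
      = qInv q N * qInv q (N + c) := by
  induction N generalizing c with
  | zero =>
    rw [tsum_eq_single 0]
    · simp [qInv_zero]
    · intro k hk
      rcases lt_or_gt_of_ne hk with h | h
      · rw [qInv_of_neg q (n := k) (by omega)]; simp
      · rw [qInv_of_neg q (n := ((0 : ℕ) : ℤ) - k) (by omega)]; simp
  | succ N ih =>
    have hs : ∀ (M : ℕ) (c : ℤ), Summable fun k : ℤ =>
        q ^ (k * (k + c)) * (qInv q k * qInv q (M - k) * qInv q (k + c)) := fun M c => by
      refine summable_of_forall_lt M fun k hk => ?_
      rcases lt_abs.1 hk with h | h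
      · rw [qInv_of_neg q (n := (M : ℤ) - k) (by omega)]; simp
      · rw [qInv_of_neg q (n := k) (by omega)]; simp
    set g : ℤ → ℂ := fun k =>
      q ^ (k * (k + (c + 1))) * (qInv q k * qInv q (N - k) * qInv q (k + (c + 1))) with hg
    have hg0 : Summable g := hs N (c + 1)
    have hm : Summable fun k => g (k - 1) := hg0.comp_injective sub_left_injective
    have em : ∑' k, g (k - 1) = ∑' k, g k := (Equiv.subRight (1 : ℤ)).tsum_eq g
    have key : ∀ k : ℤ, (1 - q ^ (N + 1)) *
        (q ^ (k * (k + c)) * (qInv q k * qInv q ((N + 1 : ℕ) - k) * qInv q (k + c)))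
        = q ^ (k * (k + c)) * (qInv q k * qInv q (N - k) * qInv q (k + c))
          + q ^ (N + 1 + c : ℤ) * g (k - 1) := fun k => by
      have a1 : qInv q (N - k) = (1 - q ^ (N + 1) / q ^ k) * qInv q (N + 1 - k) := by
        rw [← zpow_natCast, ← zpow_sub₀ hq0, Nat.cast_succ, ← qInv_sub_one hq]; congr 1; ring
      have t1 : q ^ ((k - 1) * (k + c)) = q ^ (k * (k + c)) / (q ^ k * q ^ c) := by
        rw [← zpow_add₀ hq0, ← zpow_sub₀ hq0]; congr 1; ring
      simp only [hg]
      rw [a1, show k - 1 + (c + 1) = k + c by ring, show (N : ℤ) - (k - 1) = N + 1 - k by ring,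
        qInv_sub_one hq, t1, zpow_add₀ hq0, zpow_add₀ hq0]
      push_cast
      simp only [zpow_one, zpow_natCast]
      field_simp
      ring
    have h1 := one_sub_pow_ne_zero hq (n := N + 1) (by omega)
    have e1 : qInv q N = (1 - q ^ (N + 1)) * qInv q (N + 1 : ℕ) := by
      rw [← zpow_natCast, ← qInv_sub_one hq]; congr 1; push_cast; ring
    have e2 : qInv q (N + c) = (1 - q ^ (N + 1 + c : ℤ)) * qInv q (N + 1 + c) := by
      rw [← qInv_sub_one hq]; congr 1; ring
    apply mul_left_cancel₀ h1
    rw [← tsum_mul_left]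
    simp_rw [key]
    rw [(hs N c).tsum_add (hm.mul_left _), tsum_mul_left, em, ih, ih, e1, e2,
      show (N : ℤ) + (c + 1) = N + 1 + c by ring]
    push_cast
    ring

theorem tsum_qInv_mul_qInv {q : ℂ} (hq : ‖q‖ < 1) (hq0 : q ≠ 0) (c : ℤ) :
    ∑' k : ℤ, q ^ (k * (k + c)) * (qInv q k * qInv q (k + c)) = (qPochInf q q)⁻¹ := by
  obtain ⟨C, hC0, hC⟩ := exists_norm_qInv_le hq
  have hs : Summable fun k : ℤ => ‖q ^ (k * (k + c))‖ := by
    -- With s = |c| + 1, the bound reduces to |k|² - s|k| + s² ≥ 0.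
    refine summable_norm_zpow hq hq0 _ ((|c| + 1) ^ 2) fun k => ?_
    have h1 : -(|k| * |c|) ≤ k * c := by rw [← abs_mul]; exact neg_abs_le _
    nlinarith [abs_mul_abs_self k, abs_nonneg c, abs_nonneg k, sq_nonneg (|k| - |c| - 1)]
  have h := tendsto_tsum_of_dominated_convergence (𝓕 := (atTop : Filter ℕ))
    (f := fun N k => q ^ (k * (k + c)) * (qInv q k * qInv q (N - k) * qInv q (k + c)))
    (g := fun k => q ^ (k * (k + c)) * (qInv q k * (qPochInf q q)⁻¹ * qInv q (k + c)))
    (hs.mul_right (C * C * C)) (fun k => ?_) (Eventually.of_forall fun N k => ?_)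
  · simp_rw [tsum_qInv_vandermonde hq hq0] at h
    have h2 : Tendsto (fun N : ℕ => qInv q N * qInv q (N + c)) atTop
        (𝓝 ((qPochInf q q)⁻¹ * (qPochInf q q)⁻¹)) :=
      ((tendsto_qInv hq).comp tendsto_natCast_atTop_atTop).mul ((tendsto_qInv hq).comp
        (tendsto_atTop_atTop.2 fun b => ⟨(b - c).toNat, fun n hn => by omega⟩))
    have h3 := tendsto_nhds_unique h h2
    apply mul_right_cancel₀ (inv_ne_zero (qPochInf_self_ne_zero hq))
    rw [← h3, ← tsum_mul_right]
    exact tsum_congr fun k => by ring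
  · refine Tendsto.const_mul _ (Tendsto.mul_const _ (Tendsto.const_mul _ ?_))
    exact (tendsto_qInv hq).comp
      (tendsto_atTop_atTop.2 fun b => ⟨(b + k).toNat, fun n hn => by omega⟩)
  · rw [norm_mul, norm_mul, norm_mul (qInv q _)]
    gcongr <;> exact hC _

theorem tsum_sq_mul_qInv {q : ℂ} (hq : ‖q‖ < 1) (hq0 : q ≠ 0) (j : ℤ) :
    ∑' n : ℕ, q ^ (n ^ 2) * (qInv q (n - j) * qInv q (n + j)) = q ^ (j ^ 2) * (qPochInf q q)⁻¹ := by
  set f : ℤ → ℂ := fun n => q ^ (n ^ 2) * (qInv q (n - j) * qInv q (n + j)) with hf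
  have h1 : ∑' n : ℕ, f n = ∑' n, f n := by
    refine Nat.cast_injective.tsum_eq (f := f) fun n hn => ?_
    rw [Function.mem_support] at hn
    by_contra h
    have hneg : n < 0 := by
      by_contra h'
      exact h ⟨n.toNat, by omega⟩
    apply hn
    rcases lt_or_ge j 0 with hj | hj
    · simp [hf, qInv_of_neg q (n := n + j) (by omega)]
    · simp [hf, qInv_of_neg q (n := n - j) (by omega)]
  have h2 : ∑' k, f (k + j) = ∑' n, f n := (Equiv.addRight j).tsum_eq f
  have h3 : ∀ n : ℕ, q ^ (n ^ 2) * (qInv q (n - j) * qInv q (n + j)) = f n := fun n => by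
    simp only [hf]; rw [← zpow_natCast]; push_cast; rfl
  simp_rw [h3]
  -- Shifting n = k + j gives n² = k(k + 2j) + j².
  rw [h1, ← h2, ← tsum_qInv_mul_qInv hq hq0 (2 * j), ← tsum_mul_left]
  refine tsum_congr fun k => ?_
  simp only [hf]
  rw [← mul_assoc (q ^ j ^ 2), ← zpow_add₀ hq0, add_sub_cancel_right,
    show k + j + j = k + 2 * j by ring]
  congr 2
  ring

/-! ### The Bailey pair, by telescoping -/

theorem one_add_pow_ne_zero {q : ℂ} (hq : ‖q‖ < 1) {n : ℕ} (hn : n ≠ 0) : 1 + q ^ n ≠ 0 := by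
  intro h
  apply one_sub_pow_ne_zero hq (n := n * 2) (by omega)
  rw [pow_mul]
  linear_combination (1 - q ^ n) * h

/-- The terms of the left-hand side of `tsum_baileyLeft`. -/
noncomputable def baileyLeft (q : ℂ) (n : ℕ) (m : ℤ) : ℂ :=
  (-1) ^ m * q ^ (5 * tri m + m) * (1 + q ^ m) * (1 - q ^ (n + 2 * m))
    * (qInv q (n - 2 * m) * qInv q (n + 2 * m)) / (1 - q ^ (2 * n))

/-- The terms of even index on the right-hand side of `tsum_baileyLeft`. -/
noncomputable def baileyEven (q : ℂ) (n : ℕ) (m : ℤ) : ℂ :=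
  (-1) ^ m * q ^ (5 * tri m + 2 * m) * (qInv q (n - 2 * m) * qInv q (n + 2 * m))

/-- The terms of odd index on the right-hand side of `tsum_baileyLeft`. -/
noncomputable def baileyOdd (q : ℂ) (n : ℕ) (m : ℤ) : ℂ :=
  (-1) ^ m * q ^ (5 * tri m + 4 * m)
    * (qInv q (n - (2 * m + 1)) * qInv q (n + (2 * m + 1)))

/-- The remainder left by the terms with `-m ≤ k < m` in `tsum_baileyLeft`. -/
noncomputable def baileyRem (q : ℂ) (n : ℕ) (m : ℤ) : ℂ :=
  (-1) ^ m * q ^ (5 * tri m + 2 * m) * (q ^ (2 * m) - q ^ n) / (1 + q ^ n)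
    * (qInv q (n - 2 * m) * qInv q (n + 2 * m)) - baileyLeft q n m + baileyEven q n m

/-- The first term of `baileyRem` is the discrepancy over the symmetric ranges |k| ≤ m on the left
and |j| ≤ 2m on the right; the other two terms remove the unpaired k = m. -/
theorem baileyRem_add_one {q : ℂ} (hq : ‖q‖ < 1) (hq0 : q ≠ 0) {n : ℕ} (hn : n ≠ 0) (m : ℤ) :
    (baileyLeft q n m - (baileyEven q n m + baileyOdd q n m))
      + (baileyLeft q n (-(m + 1)) - (baileyEven q n (-(m + 1)) + baileyOdd q n (-(m + 1))))
      = baileyRem q n (m + 1) - baileyRem q n m := by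
  have h1 := one_add_pow_ne_zero hq hn
  have h2 := one_sub_pow_ne_zero hq hn
  have h3 : 1 - q ^ (2 * n) = (1 - q ^ n) * (1 + q ^ n) := by rw [mul_comm 2, pow_mul]; ring
  have ht : tri (-(m + 1)) = tri m + 2 * m + 1 := by
    have := two_mul_tri m
    have := two_mul_tri (-(m + 1))
    linarith
  have s1 : ((-1 : ℂ)) ^ (-(m + 1)) = -(-1) ^ m := by
    rw [zpow_neg, zpow_add_one₀ (by norm_num)]
    rcases Int.even_or_odd m with h | h
    · simp [h.neg_one_zpow]
    · simp [h.neg_one_zpow]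
  have s2 : ((-1 : ℂ)) ^ (m + 1) = -(-1) ^ m := by rw [zpow_add_one₀ (by norm_num)]; ring
  -- These relations express every reciprocal through `qInv q (n - 2 * m)` and `qInv q (n + (2 * m +
  -- 2))`; what remains is a rational identity in q, q^m and q^n.
  have a1 : qInv q (n - (2 * m + 1)) = (1 - q ^ n / (q ^ m) ^ 2) * qInv q (n - 2 * m) := by
    rw [← zpow_natCast, ← zpow_natCast, ← zpow_mul, ← zpow_sub₀ hq0]
    rw [show (n : ℤ) - m * (2 : ℕ) = n - 2 * m by push_cast; ring, ← qInv_sub_one hq]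
    congr 1; ring
  have a2 : qInv q (n - (2 * m + 2)) =
      (1 - q ^ n / ((q ^ m) ^ 2 * q)) * qInv q (n - (2 * m + 1)) := by
    rw [← zpow_natCast, ← zpow_natCast, ← zpow_mul, ← zpow_add_one₀ hq0, ← zpow_sub₀ hq0]
    rw [show (n : ℤ) - (m * (2 : ℕ) + 1) = n - (2 * m + 1) by push_cast; ring, ← qInv_sub_one hq]
    congr 1; ring
  have a3 : qInv q (n + (2 * m + 1)) =
      (1 - q ^ n * (q ^ m) ^ 2 * q ^ 2) * qInv q (n + (2 * m + 2)) := by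
    rw [← zpow_natCast, ← zpow_natCast, ← zpow_natCast, ← zpow_mul, ← zpow_add₀ hq0, ← zpow_add₀ hq0]
    rw [show (n : ℤ) + m * (2 : ℕ) + (2 : ℕ) = n + (2 * m + 2) by push_cast; ring,
      ← qInv_sub_one hq]
    congr 1; ring
  have a4 : qInv q (n + 2 * m) =
      (1 - q ^ n * (q ^ m) ^ 2 * q) * qInv q (n + (2 * m + 1)) := by
    rw [← zpow_natCast, ← zpow_natCast, ← zpow_mul, ← zpow_add₀ hq0, ← zpow_add_one₀ hq0]
    rw [show (n : ℤ) + m * (2 : ℕ) + 1 = n + (2 * m + 1) by push_cast; ring,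
      ← qInv_sub_one hq]
    congr 1; ring
  have z1 : ∀ k : ℤ, q ^ (n + k : ℤ) = q ^ n * q ^ k := fun k => by
    rw [zpow_add₀ hq0, zpow_natCast]
  have z2 : ∀ k : ℤ, q ^ (2 * k) = (q ^ k) ^ 2 := fun k => by
    rw [mul_comm, zpow_mul]; norm_cast
  have z4 : ∀ k : ℤ, q ^ (4 * k) = (q ^ k) ^ 4 := fun k => by
    rw [mul_comm, zpow_mul]; norm_cast
  have z5 : ∀ k : ℤ, q ^ (5 * k) = (q ^ k) ^ 5 := fun k => by
    rw [mul_comm, zpow_mul]; norm_cast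
  have z0 : q ^ (-(m + 1)) = (q ^ m * q)⁻¹ := by rw [zpow_neg, zpow_add_one₀ hq0]
  simp only [baileyRem, baileyLeft, baileyEven, baileyOdd]
  rw [show (n : ℤ) - 2 * -(m + 1) = n + (2 * m + 2) by ring,
    show (n : ℤ) + 2 * -(m + 1) = n - (2 * m + 2) by ring,
    show (n : ℤ) - (2 * -(m + 1) + 1) = n + (2 * m + 1) by ring,
    show (n : ℤ) + (2 * -(m + 1) + 1) = n - (2 * m + 1) by ring,
    show (n : ℤ) - 2 * (m + 1) = n - (2 * m + 2) by ring,
    show (n : ℤ) + 2 * (m + 1) = n + (2 * m + 2) by ring,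
    show q ^ ((n : ℤ) - (2 * m + 2)) = q ^ n / ((q ^ m) ^ 2 * q ^ 2) by
      rw [zpow_sub₀ hq0, zpow_add₀ hq0, z2, zpow_natCast]; norm_cast,
    show q ^ ((n : ℤ) + (2 * m + 2)) = q ^ n * ((q ^ m) ^ 2 * q ^ 2) by
      rw [zpow_add₀ hq0, zpow_add₀ hq0, z2, zpow_natCast]; norm_cast,
    a2, a1, a4, a3, ht, tri_add_one, s1, s2, h3, z1]
  simp only [zpow_add₀ hq0, z2, z4, z5, z0, zpow_one]
  field_simp
  ring

theorem qInv_mul_qInv_eq_zero (q : ℂ) {n j : ℤ} (h : n < |j|) :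
    qInv q (n - j) * qInv q (n + j) = 0 := by
  rcases lt_abs.1 h with h | h
  · rw [qInv_of_neg q (n := n - j) (by omega), zero_mul]
  · rw [qInv_of_neg q (n := n + j) (by omega), mul_zero]

theorem tsum_baileyLeft {q : ℂ} (hq : ‖q‖ < 1) (hq0 : q ≠ 0) {n : ℕ} (hn : n ≠ 0) :
    ∑' m, baileyLeft q n m = ∑' m, (baileyEven q n m + baileyOdd q n m) := by
  have hf : ∀ m : ℤ, (n : ℤ) < |m| → qInv q (n - 2 * m) * qInv q (n + 2 * m) = 0 := fun m hm =>
    qInv_mul_qInv_eq_zero q (by rw [abs_mul, abs_two]; omega)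
  have sl : Summable (baileyLeft q n) := summable_of_forall_lt n fun m hm => by
    simp [baileyLeft, hf m hm]
  have se : Summable (baileyEven q n) := summable_of_forall_lt n fun m hm => by
    simp [baileyEven, hf m hm]
  have so : Summable (baileyOdd q n) := summable_of_forall_lt n fun m hm => by
    rw [baileyOdd, qInv_mul_qInv_eq_zero q, mul_zero]
    rcases lt_abs.1 hm with h | h
    · exact lt_abs.2 (Or.inl (by omega))
    · exact lt_abs.2 (Or.inr (by omega))
  rw [← sub_eq_zero, ← sl.tsum_sub (se.add so)]
  -- The partial sums pair m with -(m + 1), matching `baileyRem_add_one`.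
  have hd := (sl.sub (se.add so)).hasSum.nat_add_neg_add_one.tendsto_sum_nat
  refine tendsto_nhds_unique hd (tendsto_const_nhds.congr' ?_)
  have h1 := one_add_pow_ne_zero hq hn
  have h2 := one_sub_pow_ne_zero hq hn
  have h3 : 1 - q ^ (2 * n) = (1 - q ^ n) * (1 + q ^ n) := by rw [mul_comm 2, pow_mul]; ring
  have h0 : baileyRem q n 0 = 0 := by
    simp [baileyRem, baileyLeft, baileyEven, tri, h3]
    field_simp
    ring
  filter_upwards [eventually_gt_atTop n] with M hM
  have hsum := Finset.sum_range_sub (fun i : ℕ => baileyRem q n i) M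
  have hM0 : baileyRem q n M = 0 := by
    have := hf M (by rw [Nat.abs_cast]; exact_mod_cast hM)
    simp [baileyRem, baileyLeft, baileyEven, this]
  rw [Nat.cast_zero, h0, hM0, sub_zero] at hsum
  rw [← hsum]
  refine Finset.sum_congr rfl fun i _ => ?_
  rw [Nat.cast_succ, ← baileyRem_add_one hq hq0 hn]

/-- This is the leading 1 of the theorem. The case n = 0 is separate because `baileyLeft` divides by
1 - q^(2n). -/
theorem tsum_bailey_zero (q : ℂ) : ∑' m, (baileyEven q 0 m + baileyOdd q 0 m) = 1 := by
  rw [tsum_eq_single 0]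
  · rw [baileyOdd, qInv_mul_qInv_eq_zero q (by norm_num)]
    simp [baileyEven, tri, qInv_zero]
  · intro m hm
    rw [baileyOdd, qInv_mul_qInv_eq_zero q (Int.natCast_zero ▸ abs_pos.2 (by omega)), baileyEven,
      qInv_mul_qInv_eq_zero q (Int.natCast_zero ▸ abs_pos.2 (by omega))]
    simp

/-! ### The summands of the theorem as a Bailey pair -/

theorem qBinom_eq (q : ℂ) (N : ℕ) (k : ℤ) :
    qBinom q N k = qPoch q q N * (qInv q k * qInv q (N - k)) := by
  unfold qBinom
  split_ifs with h
  · have h1 : ((N : ℤ) - k).toNat = N - k.toNat := by omega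
    rw [qInv, qInv, if_pos h.1, if_pos (by omega), h1, ← mul_inv, div_eq_mul_inv]
  · by_cases hk : 0 ≤ k
    · rw [qInv_of_neg q (n := (N : ℤ) - k) (by omega)]; simp
    · rw [qInv_of_neg q (n := k) (by omega)]; simp

theorem sum_Icc_eq_tsum_baileyLeft {q : ℂ} (hq : ‖q‖ < 1) (hq0 : q ≠ 0) {n : ℕ} (hn : n ≠ 0) :
    ∑ m ∈ Finset.Icc (-(((n : ℤ) - 1) / 2)) ((n : ℤ) / 2),
      (-1 : ℂ) ^ m * q ^ ((n : ℤ) ^ 2 + m * (5 * m - 3) / 2) * (1 + q ^ m)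
        / qPoch q q (2 * n) * qBinom q (2 * n - 1) ((n : ℤ) - 2 * m)
      = q ^ (n ^ 2) * ∑' m, baileyLeft q n m := by
  have hP : qPoch q q (2 * n) = qPoch q q (2 * n - 1) * (1 - q ^ (2 * n)) := by
    obtain ⟨k, hk⟩ : ∃ k, 2 * n = k + 1 := ⟨2 * n - 1, by omega⟩
    rw [hk, qPoch_succ, Nat.add_sub_cancel, ← pow_succ']
  have hrec : ∀ m : ℤ, qInv q ((2 * n - 1 : ℕ) - ((n : ℤ) - 2 * m))
      = (1 - q ^ (n + 2 * m)) * qInv q (n + 2 * m) := fun m => by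
    rw [← qInv_sub_one hq]; congr 1; omega
  have hterm : ∀ m : ℤ, (-1 : ℂ) ^ m * q ^ ((n : ℤ) ^ 2 + m * (5 * m - 3) / 2) * (1 + q ^ m)
        / qPoch q q (2 * n) * qBinom q (2 * n - 1) ((n : ℤ) - 2 * m)
      = q ^ (n ^ 2) * baileyLeft q n m := fun m => by
    have h1 := qPoch_self_ne_zero hq (2 * n - 1)
    have h2 := one_sub_pow_ne_zero hq (n := 2 * n) (by omega)
    have h3 : m * (5 * m - 3) / 2 = 5 * tri m + m := by
      have := two_mul_tri m
      rw [show m * (5 * m - 3) = 2 * (5 * tri m + m) by linarith]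
      omega
    rw [qBinom_eq, hrec, hP, h3, zpow_add₀ hq0, baileyLeft]
    rw [show q ^ ((n : ℤ) ^ 2) = q ^ (n ^ 2) by norm_cast]
    field_simp
  simp_rw [hterm]
  rw [← Finset.mul_sum, tsum_eq_sum]
  intro m hm
  rw [Finset.mem_Icc] at hm
  -- Outside the range either 2m > n or n + 2m - 1 < 0. The factor 1 - q^(n+2m) handles the edge 2m
  -- = -n.
  have h0 : qInv q (n - 2 * m) * ((1 - q ^ (n + 2 * m)) * qInv q (n + 2 * m)) = 0 := by
    rw [← qInv_sub_one hq]
    by_cases h : n < 2 * m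
    · rw [qInv_of_neg q (n := (n : ℤ) - 2 * m) (by omega), zero_mul]
    · rw [qInv_of_neg q (n := (n : ℤ) + 2 * m - 1) (by omega), mul_zero]
  rw [baileyLeft]
  rw [div_eq_zero_iff]
  left
  linear_combination ((-1) ^ m * q ^ (5 * tri m + m) * (1 + q ^ m)) * h0

/-! ### Exchange of summation and theta series -/

theorem summable_sq_mul_qInv {q : ℂ} (hq : ‖q‖ < 1) {c : ℤ → ℂ}
    (hc : Summable fun k => ‖c k‖) (j : ℤ → ℤ) :
    Summable fun p : ℕ × ℤ =>
      q ^ (p.1 ^ 2) * (c p.2 * (qInv q (p.1 - j p.2) * qInv q (p.1 + j p.2))) := by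
  obtain ⟨C, hC0, hC⟩ := exists_norm_qInv_le hq
  have hs : Summable fun n : ℕ => ‖q‖ ^ (n ^ 2) := by
    refine Summable.of_nonneg_of_le (fun n => by positivity) (fun n => ?_)
      (summable_geometric_of_lt_one (norm_nonneg q) hq)
    exact pow_le_pow_of_le_one (norm_nonneg q) hq.le (Nat.le_self_pow two_ne_zero n)
  refine Summable.of_norm_bounded ((hs.mul_of_nonneg hc (fun n => by positivity)
    (fun k => norm_nonneg _)).mul_right (C * C)) fun p => ?_
  rw [norm_mul, norm_mul, norm_mul (qInv q _), norm_pow, ← mul_assoc]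
  gcongr <;> exact hC _

theorem hasSum_sq_mul_tsum_qInv {q : ℂ} (hq : ‖q‖ < 1) (hq0 : q ≠ 0) {c : ℤ → ℂ}
    (hc : Summable fun k => ‖c k‖) (j : ℤ → ℤ) :
    (∀ n : ℕ, Summable fun k => c k * (qInv q (n - j k) * qInv q (n + j k))) ∧
    HasSum (fun n : ℕ => q ^ (n ^ 2) * ∑' k, c k * (qInv q (n - j k) * qInv q (n + j k)))
      ((∑' k, c k * q ^ (j k ^ 2)) * (qPochInf q q)⁻¹) := by
  have hs := summable_sq_mul_qInv hq hc j
  constructor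
  · intro n
    have h := hs.prod_factor n
    dsimp only at h
    exact (summable_mul_left_iff (pow_ne_zero _ hq0)).1 h
  have h := hs.prod.hasSum
  simp only [tsum_mul_left] at h
  have h2 := hs.tsum_comm (f := fun (n : ℕ) (k : ℤ) =>
    q ^ (n ^ 2) * (c k * (qInv q (n - j k) * qInv q (n + j k))))
  simp only [tsum_mul_left] at h2
  rw [← h2] at h
  convert! h using 1
  rw [← tsum_mul_right]
  refine tsum_congr fun k => ?_
  rw [mul_assoc, ← tsum_sq_mul_qInv hq hq0, ← tsum_mul_left]
  exact tsum_congr fun n => by ring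

theorem tri_bounds (m : ℤ) : 0 ≤ tri m + m ∧ 0 ≤ tri m := by
  have h := two_mul_tri m
  constructor
  · rcases le_or_gt 0 m with h1 | h1 <;> nlinarith
  · rcases le_or_gt 1 m with h1 | h1 <;> nlinarith

theorem tsum_theta_thirteen {q : ℂ} (hq : ‖q‖ < 1) (hq0 : q ≠ 0) {a : ℕ} (ha : 1 ≤ a)
    (ha' : a ≤ 12) :
    ∑' k : ℤ, (-1) ^ k * q ^ (13 * tri k + a * k)
      = qPochInf₃ (q ^ a) (q ^ (13 - a)) (q ^ 13) (q ^ 13) := by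
  have hQ : ‖q ^ 13‖ < 1 := by
    rw [norm_pow]; exact pow_lt_one₀ (norm_nonneg q) hq (by norm_num)
  have hterm : ∀ k : ℤ, (-1) ^ k * (q ^ 13) ^ tri k * (q ^ a) ^ k
      = (-1) ^ k * q ^ (13 * tri k + a * k) := fun k => by
    rw [zpow_add₀ hq0, zpow_mul, zpow_mul, mul_assoc]; norm_cast
  have h := jacobi_triple_product hQ (pow_ne_zero 13 hq0) (pow_ne_zero a hq0) ?_
  · simp_rw [hterm] at h
    rw [h, pow_sub₀ q hq0 (by omega), div_eq_mul_inv]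
  · simp_rw [hterm, norm_mul, norm_zpow (-1 : ℂ), norm_neg, norm_one, one_zpow, one_mul]
    refine summable_norm_zpow hq hq0 _ 0 fun k => ?_
    obtain ⟨h1, h2⟩ := tri_bounds k
    -- These add to 11 `tri k` + (a - 1)k ≥ 0; adding 2 `tri k` or 2(`tri k` + k) gives the two
    -- sides of the bound on |k|.
    have h1' := mul_nonneg (by omega : (0 : ℤ) ≤ a - 1) h1
    have h2' := mul_nonneg (by omega : (0 : ℤ) ≤ 12 - a) h2
    exact abs_le.2 ⟨by linarith, by linarith⟩

theorem hasSum_bailey {q : ℂ} (hq : ‖q‖ < 1) (hq0 : q ≠ 0) :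
    HasSum (fun n : ℕ => q ^ (n ^ 2) * ∑' m, (baileyEven q n m + baileyOdd q n m))
      (1 / qPochInf q q * (qPochInf₃ (q ^ 6) (q ^ 7) (q ^ 13) (q ^ 13)
        + q * qPochInf₃ q (q ^ 12) (q ^ 13) (q ^ 13))) := by
  have hs : ∀ a : ℤ, 1 ≤ a → a ≤ 4 →
      Summable fun k : ℤ => ‖(-1 : ℂ) ^ k * q ^ (5 * tri k + a * k)‖ := fun a h1 h4 => by
    simp_rw [norm_mul, norm_zpow (-1 : ℂ), norm_neg, norm_one, one_zpow, one_mul]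
    refine summable_norm_zpow hq hq0 _ 0 fun k => ?_
    obtain ⟨h1, h2⟩ := tri_bounds k
    have h1' := mul_nonneg (by omega : (0 : ℤ) ≤ a - 1) h1
    have h2' := mul_nonneg (by omega : (0 : ℤ) ≤ 4 - a) h2
    exact abs_le.2 ⟨by linarith, by linarith⟩
  obtain ⟨e1, e2⟩ := hasSum_sq_mul_tsum_qInv hq hq0 (hs 2 (by norm_num) (by norm_num)) fun k => 2 * k
  obtain ⟨o1, o2⟩ := hasSum_sq_mul_tsum_qInv hq hq0 (hs 4 (by norm_num) (by norm_num))
    fun k => 2 * k + 1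
  have h := e2.add o2
  have t1 : ∑' k : ℤ, (-1) ^ k * q ^ (5 * tri k + 2 * k) * q ^ ((2 * k) ^ 2)
      = qPochInf₃ (q ^ 6) (q ^ 7) (q ^ 13) (q ^ 13) := by
    rw [← tsum_theta_thirteen hq hq0 (a := 6) (by norm_num) (by norm_num)]
    refine tsum_congr fun k => ?_
    rw [mul_assoc, ← zpow_add₀ hq0]
    congr 2
    push_cast
    linarith [two_mul_tri k]
  have t2 : ∑' k : ℤ, (-1) ^ k * q ^ (5 * tri k + 4 * k) * q ^ ((2 * k + 1) ^ 2)
      = q * qPochInf₃ q (q ^ 12) (q ^ 13) (q ^ 13) := by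
    -- The odd exponent is 13 `tri k` + 12k + 1, so z = q^12 and q^13/z = q.
    have h12 := tsum_theta_thirteen hq hq0 (a := 12) (by norm_num) (by norm_num)
    rw [show qPochInf₃ q (q ^ 12) (q ^ 13) (q ^ 13)
      = qPochInf₃ (q ^ 12) (q ^ (13 - 12)) (q ^ 13) (q ^ 13) by
        simp only [qPochInf₃, Nat.reduceSub, pow_one]; ring, ← h12, ← tsum_mul_left]
    refine tsum_congr fun k => ?_
    rw [mul_assoc, ← zpow_add₀ hq0, mul_left_comm, ← zpow_one_add₀ hq0]
    congr 2
    push_cast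
    linarith [two_mul_tri k]
  rw [t1, t2, ← add_mul, mul_comm, ← one_div] at h
  convert h using 2 with n
  rw [← mul_add, ← (e1 n).tsum_add (o1 n)]
  rfl

theorem mainTheorem4 (q : ℂ) (hq : ‖q‖ < 1) :
    ∃ S : ℂ,
      HasSum (fun n : ℕ+ =>
        ∑ m ∈ Finset.Icc (-(((n : ℤ) - 1) / 2)) ((n : ℤ) / 2),
          (-1 : ℂ) ^ m * q ^ ((n : ℤ) ^ 2 + m * (5 * m - 3) / 2) * (1 + q ^ m)
            / qPoch q q (2 * (n : ℕ)) * qBinom q (2 * (n : ℕ) - 1) ((n : ℤ) - 2 * m)) S ∧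
      1 + S =
        1 / qPochInf q q *
          (qPochInf₃ (q ^ 6) (q ^ 7) (q ^ 13) (q ^ 13)
            + q * qPochInf₃ q (q ^ 12) (q ^ 13) (q ^ 13)) := by
  rcases eq_or_ne q 0 with rfl | hq0
  · refine ⟨0, ?_, by simp [qPochInf, qPochInf₃]⟩
    convert hasSum_zero (α := ℂ) (β := ℕ+) using 2 with n
    refine Finset.sum_eq_zero fun m _ => ?_
    -- At q = 0 the exponent is positive, since m(5m - 3) ≥ 0 for every integer m, so each summand
    -- is zero.
    have h1 : (0 : ℤ) < n := by exact_mod_cast n.pos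
    have h2 : 0 ≤ m * (5 * m - 3) / 2 := by
      apply Int.ediv_nonneg _ (by norm_num)
      rcases le_or_gt 1 m with h | h <;> nlinarith
    rw [zero_zpow _ (by positivity)]
    simp
  · have h := (hasSum_nat_add_iff' 1).2 (hasSum_bailey hq hq0)
    refine ⟨_, (Equiv.pnatEquivNat.hasSum_iff.2 h).congr_fun ?_, ?_⟩
    · intro n
      have hn : (n : ℕ) - 1 + 1 = n := Nat.sub_add_cancel n.pos
      rw [sum_Icc_eq_tsum_baileyLeft hq hq0 n.ne_zero, tsum_baileyLeft hq hq0 n.ne_zero]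
      simp [Equiv.pnatEquivNat, PNat.natPred, hn]
    · simp [tsum_bailey_zero]
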